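/- Let $(y_i,\mathbf x_i)_{i=1}^n$ follow the model $y_i=\mathbf x_i^\top\boldsymbol\beta^*+\mu^*+\sqrt n\,\theta_i+\xi_i$, where $\boldsymbol\beta^*\in\mathbb R^d$, $\mu^*\in\mathbb R$, and $\theta_i=0$ for every $i\notin\mathcal O$, with $|\mathcal O|=o$; the set $\mathcal O\subset\{1,\dots,n\}$ and the values $\theta_i$, $i\in\mathcal O$, are chosen by an adversary and may depend on all the data. Assume the following. - The covariates $\mathbf x_i$ are i.i.d. with mean zero and covariance matrix $\Sigma$, and they are $L$-subGaussian: with $\|\mathbf v\|_\Sigma=\sqrt{\mathbf v^\top\Sigma\mathbf v}$ and $\|f\|_{\psi_2}=\inf\{\eta>0:\mathbb E\exp(f^2/\eta^2)\le 2\}$, one has $\|\langle\mathbf x_i,\mathbf v\rangle\|_{\psi_2}\le L\|\mathbf v\|_\Sigma$ for all $\mathbf v\in\mathbb R^d$, where $L>0$. Moreover $\max_j\Sigma_{jj}\le\rho^2$ with $\rho>0$. - The noise variables $\xi_i$ are i.i.d. with $\mathbb E\xi_i=0$ and $\mathbb E\xi_i^2=(\sigma^*)^2<\infty$, $\sigma^*\ge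 0$. - $0<\delta\le 1/9$, $O\ge o$, and $n=\mathrm B N\geq 1$ with integers $\mathrm B,N$, where $\mathrm B=\lceil\max\{128\log(1/\delta),8O\}\rceil$. For $\mathbf v\in\mathbb R^d$ let $\|\mathbf v\|_{\boldsymbol\lambda}=\sum_{i=1}^d\lambda_i v_i^\sharp$, where $\lambda_i=\sqrt{\log(ed/i)/n}$ and $v_1^\sharp\ge\dots\ge v_d^\sharp$ is the non-increasing rearrangement of $|v_1|,\dots,|v_d|$. Let $r_\Sigma,\mathrm R_{\boldsymbol\lambda}\ge 0$ be any numbers with $\rho\,\mathrm R_{\boldsymbol\lambda}\le 1$, and let $\hat{\boldsymbol\beta}$ be any, possibly data-dependent, vector such that almost surely $$\hat{\boldsymbol\beta}-\boldsymbol\beta^*\in \mathrm V_{\mathrm{mean}}:=\{\mathbf v\in\mathbb R^d:\ \|\mathbf v\|_\Sigma\le\sigma^*r_\Sigma,\ \|\mathbf v\|_{\boldsymbol\lambda}\le\sigma^*\mathrm R_{\boldsymbol\lambda}r_\Sigma\}.$$ Let $\hat\mu$ be a median of the $\mathrm B$ block means $\frac1N\sum_{i=(k-1)N+1}^{kN}(y_i-\mathbf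 x_i^\top\hat{\boldsymbol\beta})$, $k=1,\dots,\mathrm B$. Then, with probability at least $1-\delta$, $$|\hat\mu-\mu^*|\le C\left[\sigma^*(1+r_\Sigma)\left(\sqrt{\frac{O}{n}}+\sqrt{\frac{\log(1/\delta)}{n}}\right)+L\sigma^*r_\Sigma\right],$$ where $C>0$ is a universal numerical constant. -/

import Mathlib

open MeasureTheory ProbabilityTheory
open scoped ENNReal

noncomputable section

/-- The Orlicz norm `‖f‖_{ψ_α} = inf {η > 0 : E exp(|f/η|^α) ≤ 2}`, valued in `[0, ∞]`
(it is `∞` if there is no such `η`). -/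
def psiNorm {Ω : Type*} [MeasurableSpace Ω] (α : ℝ) (f : Ω → ℝ) (P : Measure Ω) : ℝ≥0∞ :=
  ⨅ (η : ℝ) (_ : 0 < η) (_ : ∫⁻ ω, ENNReal.ofReal (Real.exp (|f ω / η| ^ α)) ∂P ≤ 2),
    ENNReal.ofReal η

/-- The covariance matrix `Σ` of a law on `ℝ^d`. -/
def covMat {d : ℕ} (ν : Measure (EuclideanSpace ℝ (Fin d))) : Matrix (Fin d) (Fin d) ℝ :=
  Matrix.of fun j k => covariance (fun x => x j) (fun x => x k) ν

/-- `‖v‖_S = √(vᵀ S v)`. -/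
def matNorm {d : ℕ} (S : Matrix (Fin d) (Fin d) ℝ) (v : EuclideanSpace ℝ (Fin d)) : ℝ :=
  Real.sqrt (v.ofLp ⬝ᵥ S.mulVec v.ofLp)

/-- A mean-zero law on `ℝ^d` is `L`-subGaussian if `‖⟨x, v⟩‖_{ψ₂} ≤ L ‖v‖_Σ` for every `v`.
(The `ψ₂` bound forces all moments of the coordinates to be finite.) -/
structure IsSubGaussianLaw {d : ℕ} (L : ℝ) (ν : Measure (EuclideanSpace ℝ (Fin d))) : Prop where
  mean_zero : ∀ j, ∫ x, x j ∂ν = 0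
  psi_le : ∀ v : EuclideanSpace ℝ (Fin d),
    psiNorm 2 (fun x => inner ℝ x v) ν ≤ ENNReal.ofReal (L * matNorm (covMat ν) v)

/-- The SLOPE norm `∑ᵢ λᵢ |v|♯ᵢ`, with `|v|♯` the non-increasing rearrangement of the absolute
values of the entries: `Tuple.sort (fun j => -|v j|)` lists the indices by decreasing `|v j|`. -/
def slopeNorm {d : ℕ} (lam : Fin d → ℝ) (v : EuclideanSpace ℝ (Fin d)) : ℝ :=
  ∑ i : Fin d, lam i * |v (Tuple.sort (fun j => -|v j|) i)|

/-- The weights `λᵢ = √(log(e d / i) / n)`, `i = 1, …, d` (indices start at `0` in the code). -/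
def slopeWeight (n d : ℕ) (i : Fin d) : ℝ :=
  Real.sqrt (Real.log (Real.exp 1 * (d : ℝ) / ((i : ℕ) + 1 : ℝ)) / (n : ℝ))

/-- `V_mean = {v : ‖v‖_Σ ≤ σ r, ‖v‖_λ ≤ σ R r}`, for covariates with law `ν`. -/
def Vmean {d : ℕ} (n : ℕ) (ν : Measure (EuclideanSpace ℝ (Fin d))) (σ r R : ℝ) :
    Set (EuclideanSpace ℝ (Fin d)) :=
  {v | matNorm (covMat ν) v ≤ σ * r ∧ slopeNorm (slopeWeight n d) v ≤ σ * R * r}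

/-- The mean of the `k`-th block of `N` consecutive entries of `z` (`k` starts at `0`). -/
def blockMean {n : ℕ} (N : ℕ) (z : Fin n → ℝ) (k : ℕ) : ℝ :=
  (1 / (N : ℝ)) *
    ∑ i ∈ Finset.univ.filter (fun i : Fin n => k * N ≤ i.val ∧ i.val < (k + 1) * N), z i

/-- `m` is a median of `a`: at least half of the entries are `≤ m` and at least half are `≥ m`. -/
def IsMedian {B : ℕ} (a : Fin B → ℝ) (m : ℝ) : Prop :=
  B ≤ 2 * (Finset.univ.filter fun k => a k ≤ m).card ∧
    B ≤ 2 * (Finset.univ.filter fun k => m ≤ a k).card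

/-- `m` is an output of block-wise median-of-means intercept estimation on the data `(yᵢ, xᵢ)`
with coefficient estimate `b`, `B` blocks and block length `N`. -/
def IsInterceptEstimate {n d : ℕ} (B N : ℕ) (y : Fin n → ℝ)
    (x : Fin n → EuclideanSpace ℝ (Fin d)) (b : EuclideanSpace ℝ (Fin d)) (m : ℝ) : Prop :=
  IsMedian (fun k : Fin B => blockMean N (fun i => y i - inner ℝ (x i) b) k) m

end

/-! A median is close to `μstar` as soon as fewer than half of the block means are far from it. Each
outlier spoils at most one block, so at most `B / 8` blocks contain one. On any other block the
error is the mean of the noise minus the mean of `⟨x i, βhat - βstar⟩`, and these two are controlled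
separately, so no independence between noise and covariates is needed.

Noise: by Chebyshev a block sum exceeds `exp 8 * σ * √N` with probability at most `exp (-16)`.
Independence of the blocks and a union bound over the `2 ^ B` sets of blocks show that fewer than `B
/ 8` blocks are bad, outside an event of probability `exp (-B)`.

Covariates: `βhat` depends on the data, so the bound must be uniform over `Vmean`. If `B / 16`
blocks had a large sum in one direction `v`, so would the sum over their union `I`, a fixed fraction
of the sample. For fixed `I`, `measure_exists_lt_inner_sum_le` excludes this for all `v` at once
with probability `1 - exp (-2 n)`, and a union bound over sets of blocks follows.

The uniform bound is a PAC-Bayes form of Maurey's argument. A vector of the SLOPE ball is `n` times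
the mean of a law on finitely many atoms `± √l a e_j`, whose relative entropy to a fixed weight of
total mass at most 5 is at most 2. Jensen's inequality, used `n` times (`exp_le_iteratedSum`),
bounds the exponential of the linear form minus a quadratic penalty, at every `v`, by one random
variable that does not involve `v`, up to a factor `exp (O(|I| + n))`. Sub-Gaussianity bounds its
expectation by `5 ^ n` (`lintegral_iteratedSum_le`), and Markov's inequality concludes. -/

/-! ### From the `ψ₂` norm to the moment generating function. -/

theorem Real.exp_le_add_exp_sq (u : ℝ) : Real.exp u ≤ u + Real.exp (u ^ 2) := by
  rcases le_total |u| 1 with hu | hu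
  · have h₁ := (abs_le.1 (Real.abs_exp_sub_one_sub_id_le hu)).2
    have h₂ := Real.add_one_le_exp (u ^ 2)
    linarith
  · rcases le_total 0 u with h0 | h0
    · rw [abs_of_nonneg h0] at hu
      have : Real.exp u ≤ Real.exp (u ^ 2) := Real.exp_le_exp.2 (by nlinarith)
      linarith
    · rw [abs_of_nonpos h0] at hu
      have h₁ : Real.exp (-u) ≤ Real.exp (u ^ 2) := Real.exp_le_exp.2 (by nlinarith)
      have h₂ := Real.add_one_le_exp (-u)
      have h₃ := Real.exp_le_one_iff.2 h0
      linarith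

theorem Real.exp_mul_le_of_mem_Icc {θ : ℝ} (h0 : 0 ≤ θ) (h1 : θ ≤ 1) (u : ℝ) :
    Real.exp (θ * u) ≤ 1 - θ + θ * Real.exp u := by
  have := convexOn_exp.2 (Set.mem_univ 0) (Set.mem_univ u) (sub_nonneg.2 h1) h0 (by ring)
  simpa using this

section MGF

variable {Ω : Type*} [MeasurableSpace Ω] {P : Measure Ω} {f : Ω → ℝ} {η : ℝ}

theorem integrable_exp_sq_of_lintegral_le (hf : AEMeasurable f P)
    (h : ∫⁻ ω, ENNReal.ofReal (Real.exp ((f ω / η) ^ 2)) ∂P ≤ 2) :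
    Integrable (fun ω => Real.exp ((f ω / η) ^ 2)) P := by
  refine ⟨by fun_prop, ?_⟩
  rw [hasFiniteIntegral_iff_ofReal (ae_of_all _ fun _ => (Real.exp_pos _).le)]
  exact h.trans_lt (by simp)

theorem integral_exp_sq_le_two (hf : AEMeasurable f P)
    (h : ∫⁻ ω, ENNReal.ofReal (Real.exp ((f ω / η) ^ 2)) ∂P ≤ 2) :
    ∫ ω, Real.exp ((f ω / η) ^ 2) ∂P ≤ 2 := by
  rw [integral_eq_lintegral_of_nonneg_ae (ae_of_all _ fun _ => (Real.exp_pos _).le) (by fun_prop)]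
  exact ENNReal.toReal_le_of_le_ofReal (by norm_num) (by simpa using h)

theorem memLp_two_of_lintegral_exp_sq_le (hη : 0 < η) (hf : AEMeasurable f P)
    (h : ∫⁻ ω, ENNReal.ofReal (Real.exp ((f ω / η) ^ 2)) ∂P ≤ 2) : MemLp f 2 P := by
  rw [memLp_two_iff_integrable_sq hf.aestronglyMeasurable]
  refine ((integrable_exp_sq_of_lintegral_le hf h).const_mul (η ^ 2)).mono' (by fun_prop)
    (ae_of_all _ fun ω => ?_)
  rw [Real.norm_of_nonneg (sq_nonneg _)]
  have h₁ := Real.add_one_le_exp ((f ω / η) ^ 2)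
  have h₂ : f ω ^ 2 = η ^ 2 * (f ω / η) ^ 2 := by field_simp
  rw [h₂]
  gcongr
  linarith

theorem integrable_exp_mul_of_lintegral_exp_sq_le (hη : 0 < η) (hf : AEMeasurable f P)
    (h : ∫⁻ ω, ENNReal.ofReal (Real.exp ((f ω / η) ^ 2)) ∂P ≤ 2) (t : ℝ) :
    Integrable (fun ω => Real.exp (t * f ω)) P := by
  refine ((integrable_exp_sq_of_lintegral_le hf h).const_mul (Real.exp ((t * η) ^ 2 / 4))).mono'
    (by fun_prop) (ae_of_all _ fun ω => ?_)
  rw [Real.norm_of_nonneg (Real.exp_pos _).le, ← Real.exp_add]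
  apply Real.exp_le_exp.2
  have h₁ : t * f ω = (t * η) * (f ω / η) := by field_simp
  nlinarith [sq_nonneg (t * η / 2 - f ω / η)]

/-- A centred variable with `E exp(f²/η²) ≤ 2` has `E exp(t f) ≤ exp(t² η²)`. -/
theorem mgf_le_of_lintegral_exp_sq_le [IsProbabilityMeasure P] (hη : 0 < η) (hf : AEMeasurable f P)
    (h : ∫⁻ ω, ENNReal.ofReal (Real.exp ((f ω / η) ^ 2)) ∂P ≤ 2) (hmean : ∫ ω, f ω ∂P = 0) (t : ℝ) :
    mgf f P t ≤ Real.exp ((t * η) ^ 2) := by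
  have hint := integrable_exp_sq_of_lintegral_le hf h
  have hle := integral_exp_sq_le_two hf h
  have hintf : Integrable f P := (memLp_two_of_lintegral_exp_sq_le hη hf h).integrable (by norm_num)
  have hinte := integrable_exp_mul_of_lintegral_exp_sq_le hη hf h t
  set θ := (t * η) ^ 2 with hθ
  have hθ0 : 0 ≤ θ := sq_nonneg _
  have hp : ∀ ω, t * f ω = (t * η) * (f ω / η) := fun ω => by field_simp
  -- For `θ ≤ 1` the linear term of `exp u ≤ u + exp (u ^ 2)` integrates to zero and convexity
  -- leaves `1 + θ ≤ exp θ`. For `θ ≥ 1` the inequality `a * b ≤ a ^ 2 / 4 + b ^ 2` gives `2 * exp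
  -- (θ / 4)`, and the factor 2 is absorbed because `log 2 ≤ 3 / 4`.
  rcases le_total θ 1 with h1 | h1
  · have key : mgf f P t ≤ ∫ ω, (t * f ω + (1 - θ + θ * Real.exp ((f ω / η) ^ 2))) ∂P := by
      refine integral_mono hinte (by fun_prop) fun ω => ?_
      have h₁ := Real.exp_le_add_exp_sq (t * f ω)
      have h₂ := Real.exp_mul_le_of_mem_Icc hθ0 h1 ((f ω / η) ^ 2)
      have h₃ : (t * f ω) ^ 2 = θ * (f ω / η) ^ 2 := by rw [hp, hθ]; ring
      rw [h₃] at h₁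
      dsimp only
      linarith
    rw [integral_add (by fun_prop) (by fun_prop), integral_const_mul, hmean,
      integral_add (by fun_prop) (by fun_prop), integral_const_mul] at key
    simp only [integral_const, probReal_univ, smul_eq_mul] at key
    have := Real.add_one_le_exp θ
    nlinarith
  · have key : mgf f P t ≤ ∫ ω, Real.exp (θ / 4) * Real.exp ((f ω / η) ^ 2) ∂P := by
      refine integral_mono hinte (by fun_prop) fun ω => ?_
      dsimp only
      rw [← Real.exp_add]
      apply Real.exp_le_exp.2
      have := hp ω
      nlinarith [sq_nonneg (t * η / 2 - f ω / η)]
    rw [integral_const_mul] at key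
    have h2 : (2 : ℝ) ≤ Real.exp (3 / 4 * θ) := by
      rw [← Real.log_le_iff_le_exp (by norm_num)]
      have := Real.log_two_lt_d9
      linarith
    calc mgf f P t ≤ Real.exp (θ / 4) * 2 := key.trans (by gcongr)
      _ ≤ Real.exp (θ / 4) * Real.exp (3 / 4 * θ) := by gcongr
      _ = Real.exp θ := by rw [← Real.exp_add]; congr 1; ring

theorem exists_of_psiNorm_lt {a : ℝ} (h : psiNorm 2 f P < ENNReal.ofReal a) :
    ∃ η, 0 < η ∧ η < a ∧ ∫⁻ ω, ENNReal.ofReal (Real.exp ((f ω / η) ^ 2)) ∂P ≤ 2 := by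
  simp only [psiNorm, iInf_lt_iff] at h
  obtain ⟨η, hη, hle, hlt⟩ := h
  refine ⟨η, hη, (ENNReal.ofReal_lt_ofReal_iff_of_nonneg hη.le).1 hlt, ?_⟩
  simpa [Real.rpow_two] using hle

theorem memLp_two_of_psiNorm_lt_top (hf : AEMeasurable f P) (h : psiNorm 2 f P < ∞) :
    MemLp f 2 P := by
  obtain ⟨a, ha⟩ : ∃ a : ℝ, psiNorm 2 f P < ENNReal.ofReal a := by
    refine ⟨(psiNorm 2 f P).toReal + 1, ?_⟩
    rw [ENNReal.lt_ofReal_iff_toReal_lt h.ne]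
    linarith
  obtain ⟨η, hη, -, hle⟩ := exists_of_psiNorm_lt ha
  exact memLp_two_of_lintegral_exp_sq_le hη hf hle

/-- A centred variable with `ψ₂` norm at most `a` is sub-Gaussian with variance proxy `2 a²`. -/
theorem hasSubgaussianMGF_of_psiNorm_le [IsProbabilityMeasure P] {a : ℝ} (ha : 0 ≤ a)
    (hf : AEMeasurable f P) (h : psiNorm 2 f P ≤ ENNReal.ofReal a) (hmean : ∫ ω, f ω ∂P = 0) :
    HasSubgaussianMGF f (2 * (a ^ 2).toNNReal) P := by
  have hlt : ∀ b, a < b → psiNorm 2 f P < ENNReal.ofReal b := fun b hb =>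
    h.trans_lt ((ENNReal.ofReal_lt_ofReal_iff_of_nonneg ha).2 hb)
  refine ⟨fun t => ?_, fun t => ?_⟩
  · obtain ⟨η, hη, -, hle⟩ := exists_of_psiNorm_lt (hlt (a + 1) (by linarith))
    exact integrable_exp_mul_of_lintegral_exp_sq_le hη hf hle t
  -- The infimum in the norm need not be attained, and `a` may be 0: the bound is proved for every
  -- `b > a`, then `b` tends to `a`.
  · have hb : ∀ b ∈ Set.Ioi a, mgf f P t ≤ Real.exp ((t * b) ^ 2) := fun b hb => by
      obtain ⟨η, hη, hηb, hle⟩ := exists_of_psiNorm_lt (hlt b hb)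
      refine (mgf_le_of_lintegral_exp_sq_le hη hf hle hmean t).trans (Real.exp_le_exp.2 ?_)
      rw [mul_pow, mul_pow]
      gcongr
    have hlim : Filter.Tendsto (fun b => Real.exp ((t * b) ^ 2)) (nhdsWithin a (Set.Ioi a))
        (nhds (Real.exp ((t * a) ^ 2))) :=
      Continuous.tendsto' (by fun_prop) _ _ rfl |>.mono_left nhdsWithin_le_nhds
    have := ge_of_tendsto hlim (eventually_nhdsWithin_of_forall hb)
    refine this.trans_eq ?_
    congr 1
    push_cast
    rw [Real.coe_toNNReal _ (sq_nonneg a)]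
    ring

end MGF

/-! ### The covariance form and exponential moments of covariate sums. -/

section Covariance

variable {d : ℕ} {L : ℝ} {ν : Measure (EuclideanSpace ℝ (Fin d))}

theorem IsSubGaussianLaw.memLp_inner (h : IsSubGaussianLaw L ν) (v : EuclideanSpace ℝ (Fin d)) :
    MemLp (fun x => inner ℝ x v) 2 ν :=
  memLp_two_of_psiNorm_lt_top (by fun_prop) ((h.psi_le v).trans_lt ENNReal.ofReal_lt_top)

theorem IsSubGaussianLaw.memLp_apply (h : IsSubGaussianLaw L ν) (j : Fin d) :
    MemLp (fun x : EuclideanSpace ℝ (Fin d) => x j) 2 ν := by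
  simpa [EuclideanSpace.inner_single_right] using h.memLp_inner (EuclideanSpace.single j 1)

theorem IsSubGaussianLaw.integral_inner [IsProbabilityMeasure ν] (h : IsSubGaussianLaw L ν)
    (v : EuclideanSpace ℝ (Fin d)) : ∫ x, inner ℝ x v ∂ν = 0 := by
  simp only [PiLp.inner_apply, RCLike.inner_apply, conj_trivial]
  rw [integral_finsetSum _ fun j _ => ((h.memLp_apply j).integrable (by norm_num)).const_mul (v j)]
  simp [integral_const_mul, h.mean_zero]

/-- The bilinear form `(u, w) ↦ uᵀ S w`. -/
def matBilin (S : Matrix (Fin d) (Fin d) ℝ) : LinearMap.BilinForm ℝ (EuclideanSpace ℝ (Fin d)) :=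
  LinearMap.mk₂ ℝ (fun u w => u.ofLp ⬝ᵥ S.mulVec w.ofLp)
    (by simp [add_dotProduct]) (by simp) (by simp [Matrix.mulVec_add, dotProduct_add])
    (by simp [Matrix.mulVec_smul])

theorem matBilin_apply (S : Matrix (Fin d) (Fin d) ℝ) (u w : EuclideanSpace ℝ (Fin d)) :
    matBilin S u w = u.ofLp ⬝ᵥ S.mulVec w.ofLp := rfl

theorem matBilin_single (S : Matrix (Fin d) (Fin d) ℝ) (j : Fin d) (a : ℝ) :
    matBilin S (EuclideanSpace.single j a) (EuclideanSpace.single j a) = a ^ 2 * S j j := by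
  simp [matBilin_apply, EuclideanSpace.single]
  ring

theorem IsSubGaussianLaw.matBilin_self [IsProbabilityMeasure ν] (h : IsSubGaussianLaw L ν)
    (v : EuclideanSpace ℝ (Fin d)) :
    matBilin (covMat ν) v v = Var[fun x => inner ℝ x v; ν] := by
  simp only [PiLp.inner_apply, RCLike.inner_apply, conj_trivial]
  rw [variance_fun_sum fun j => (h.memLp_apply j).const_mul (v j)]
  simp only [covariance_const_mul_left, covariance_const_mul_right, matBilin_apply, dotProduct,
    Matrix.mulVec, covMat, Matrix.of_apply, Finset.mul_sum]
  refine Finset.sum_congr rfl fun i _ => Finset.sum_congr rfl fun j _ => by ring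

theorem IsSubGaussianLaw.matBilin_self_nonneg [IsProbabilityMeasure ν] (h : IsSubGaussianLaw L ν)
    (v : EuclideanSpace ℝ (Fin d)) : 0 ≤ matBilin (covMat ν) v v := by
  rw [h.matBilin_self]
  exact variance_nonneg _ _

theorem IsSubGaussianLaw.hasSubgaussianMGF [IsProbabilityMeasure ν] (h : IsSubGaussianLaw L ν)
    (hL : 0 ≤ L) (v : EuclideanSpace ℝ (Fin d)) :
    HasSubgaussianMGF (fun x => inner ℝ x v)
      (2 * (L ^ 2 * matBilin (covMat ν) v v).toNNReal) ν := by
  have := hasSubgaussianMGF_of_psiNorm_le (mul_nonneg hL (Real.sqrt_nonneg _)) (by fun_prop)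
    (h.psi_le v) (h.integral_inner v)
  rwa [mul_pow, ← matBilin_apply, Real.sq_sqrt (h.matBilin_self_nonneg v)] at this

/-- The exponential moment of `⟨∑ xᵢ, w⟩` over a finite index set, normalised by its bound. -/
theorem IsSubGaussianLaw.lintegral_exp_sum_le {Ω ι : Type*} [MeasurableSpace Ω] {P : Measure Ω}
    [IsProbabilityMeasure P] {x : ι → Ω → EuclideanSpace ℝ (Fin d)} (h : IsSubGaussianLaw L ν)
    (hL : 0 ≤ L) (hx : iIndepFun x P) (hlaw : ∀ i, HasLaw (x i) ν P) (I : Finset ι) (t : ℝ)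
    (w : EuclideanSpace ℝ (Fin d)) :
    ∫⁻ ω, ENNReal.ofReal (Real.exp (t * inner ℝ (∑ i ∈ I, x i ω) w
      - I.card * t ^ 2 * L ^ 2 * matBilin (covMat ν) w w)) ∂P ≤ 1 := by
  rcases I.eq_empty_or_nonempty with rfl | ⟨i₀, hi₀⟩
  · simp
  have : IsProbabilityMeasure ν := by
    rw [← (hlaw i₀).map_eq]
    exact Measure.isProbabilityMeasure_map (hlaw i₀).aemeasurable
  have hi : ∀ i ∈ I, HasSubgaussianMGF (fun ω => inner ℝ (x i ω) w)
      (2 * (L ^ 2 * matBilin (covMat ν) w w).toNNReal) P := fun i _ =>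
    HasSubgaussianMGF.of_map (Y := x i) (X := fun y => inner ℝ y w) (hlaw i).aemeasurable
      (by rw [(hlaw i).map_eq]; exact h.hasSubgaussianMGF hL w)
  have hind : iIndepFun (fun i ω => inner ℝ (x i ω) w) P :=
    hx.comp (fun _ y => inner ℝ y w) fun _ => by fun_prop
  have hs := HasSubgaussianMGF.sum_of_iIndepFun hind hi
  have hle := hs.mgf_le t
  have hint := hs.integrable_exp_mul t
  simp only [sum_inner, Real.exp_sub]
  rw [← ofReal_integral_eq_lintegral_ofReal (hint.div_const _)
    (ae_of_all _ fun _ => by positivity), integral_div]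
  apply ENNReal.ofReal_le_one.2
  rw [div_le_one (Real.exp_pos _)]
  refine hle.trans_eq ?_
  congr 1
  rw [Finset.sum_const, nsmul_eq_mul]
  push_cast
  rw [Real.coe_toNNReal _ (mul_nonneg (sq_nonneg L) (h.matBilin_self_nonneg w))]
  ring

end Covariance

/-! ### Iterated sums over atoms and their variational lower bound. -/

section IteratedSum

variable {ι κ E : Type*} [Fintype ι] [Fintype κ]

/-- The `m`-fold weighted sum `∑ π(a₁) ⋯ π(aₘ) F(u + e(a₁) + ⋯ + e(aₘ))`. -/
def iteratedSum [Add E] (π : ι → ℝ) (e : ι → E) (F : E → ℝ) : ℕ → E → ℝ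
  | 0, u => F u
  | m + 1, u => ∑ a, π a * iteratedSum π e F m (u + e a)

theorem iteratedSum_nonneg [Add E] {π : ι → ℝ} (hπ : ∀ a, 0 ≤ π a) (e : ι → E) {F : E → ℝ}
    (hF : ∀ u, 0 ≤ F u) (m : ℕ) : ∀ u, 0 ≤ iteratedSum π e F m u := by
  induction m with
  | zero => exact hF
  | succ m ih => exact fun u => Finset.sum_nonneg fun a _ => mul_nonneg (hπ a) (ih _)

theorem aemeasurable_iteratedSum [Add E] {Ω : Type*} [MeasurableSpace Ω] {P : Measure Ω}
    (π : ι → ℝ) (e : ι → E) {F : Ω → E → ℝ} (hF : ∀ u, AEMeasurable (fun ω => F ω u) P) (m : ℕ) :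
    ∀ u, AEMeasurable (fun ω => iteratedSum π e (F ω) m u) P := by
  induction m with
  | zero => exact hF
  | succ m ih => exact fun u => Finset.aemeasurable_fun_sum _ fun a _ => (ih _).const_mul _

theorem lintegral_iteratedSum_le [Add E] {Ω : Type*} [MeasurableSpace Ω] {P : Measure Ω}
    {π : ι → ℝ} (hπ : ∀ a, 0 ≤ π a) (e : ι → E) {F : Ω → E → ℝ}
    (hF : ∀ u, AEMeasurable (fun ω => F ω u) P) (hF0 : ∀ ω u, 0 ≤ F ω u)
    (hF1 : ∀ u, ∫⁻ ω, ENNReal.ofReal (F ω u) ∂P ≤ 1) (m : ℕ) :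
    ∀ u, ∫⁻ ω, ENNReal.ofReal (iteratedSum π e (F ω) m u) ∂P ≤ ENNReal.ofReal (∑ a, π a) ^ m := by
  induction m with
  | zero => simpa [iteratedSum] using hF1
  | succ m ih =>
    intro u
    have hm := aemeasurable_iteratedSum π e hF m
    calc ∫⁻ ω, ENNReal.ofReal (iteratedSum π e (F ω) (m + 1) u) ∂P
        = ∑ a, ENNReal.ofReal (π a) *
            ∫⁻ ω, ENNReal.ofReal (iteratedSum π e (F ω) m (u + e a)) ∂P := by
          simp only [iteratedSum]
          simp_rw [ENNReal.ofReal_sum_of_nonneg fun a (_ : a ∈ Finset.univ) =>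
            mul_nonneg (hπ a) (iteratedSum_nonneg hπ e (hF0 _) m _), ENNReal.ofReal_mul (hπ _)]
          rw [lintegral_finsetSum' _ fun a _ => (hm _).ennreal_ofReal.const_mul _]
          exact Finset.sum_congr rfl fun a _ => lintegral_const_mul'' _ (hm _).ennreal_ofReal
      _ ≤ ∑ a, ENNReal.ofReal (π a) * ENNReal.ofReal (∑ a, π a) ^ m := by
          gcongr with a
          exact ih _
      _ = ENNReal.ofReal (∑ a, π a) ^ (m + 1) := by
          rw [← Finset.sum_mul, ← ENNReal.ofReal_sum_of_nonneg fun a _ => hπ a, pow_succ']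

theorem exp_sum_mul_le {p : κ → ℝ} (hp : ∀ k, 0 ≤ p k) (hp1 : ∑ k, p k = 1) (f : κ → ℝ) :
    Real.exp (∑ k, p k * f k) ≤ ∑ k, p k * Real.exp (f k) := by
  simpa using convexOn_exp.map_sum_le (t := Finset.univ) (fun k _ => hp k) hp1
    (fun k _ => Set.mem_univ (f k))

/-- Variational lower bound for an iterated sum of exponentials of a concave quadratic function:
any law `p` on the atoms, of mean `v` and of cost at most `D` relative to `π`, can be used. -/
theorem exp_le_iteratedSum [AddCommGroup E] [Module ℝ E] {π : ι → ℝ} (hπ : ∀ a, 0 ≤ π a)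
    (e : ι → E) (g : κ → ι) (hg : Function.Injective g) {p c : κ → ℝ} (hp : ∀ k, 0 ≤ p k)
    (hp1 : ∑ k, p k = 1) (hpπ : ∀ k, p k ≤ π (g k) * Real.exp (c k)) {D : ℝ}
    (hD : ∑ k, p k * c k ≤ D) {v : E} (hv : ∑ k, p k • e (g k) = v)
    (ℓ : E →ₗ[ℝ] ℝ) (q : LinearMap.BilinForm ℝ E) (hq : ∀ w, 0 ≤ q w w) {Q : ℝ}
    (hQ : ∑ k, p k * q (e (g k)) (e (g k)) ≤ Q) (m : ℕ) :
    ∀ u, Real.exp (ℓ (u + (m : ℝ) • v) - q (u + (m : ℝ) • v) (u + (m : ℝ) • v) - m * (Q + D)) ≤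
      iteratedSum π e (fun w => Real.exp (ℓ w - q w w)) m u := by
  induction m with
  | zero => simp [iteratedSum]
  | succ m ih =>
    intro u
    set w := u + (m : ℝ) • v with hw
    have hwv : u + ((m + 1 : ℕ) : ℝ) • v = w + v := by
      rw [hw]; push_cast; rw [add_smul, one_smul, add_assoc]
    have hℓ : ∑ k, p k * ℓ (w + e (g k)) = ℓ (w + v) := by
      simp only [map_add, mul_add, Finset.sum_add_distrib, ← Finset.sum_mul, hp1, one_mul, ← hv,
        map_sum, map_smul, smul_eq_mul]
    have hqs : ∑ k, p k * q (w + e (g k)) (w + e (g k)) ≤ q (w + v) (w + v) + Q := by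
      have h₁ : ∑ k, p k * q w (e (g k)) = q w v := by
        simp only [← hv, map_sum, map_smul, smul_eq_mul]
      have h₂ : ∑ k, p k * q (e (g k)) w = q v w := by
        simp only [← hv, map_sum, map_smul, LinearMap.sum_apply, LinearMap.smul_apply, smul_eq_mul]
      have h₃ : ∑ k, p k * q (w + e (g k)) (w + e (g k)) =
          q w w + q v w + q w v + ∑ k, p k * q (e (g k)) (e (g k)) := by
        simp only [map_add, LinearMap.add_apply, mul_add, Finset.sum_add_distrib, ← Finset.sum_mul,
          hp1, h₁, h₂]
        ring
      -- The cross terms complete `q (w + v) (w + v)` up to `- q v v`, which is dropped by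
      -- positivity.
      have := hq v
      rw [h₃]
      simp only [map_add, LinearMap.add_apply]
      linarith
    calc Real.exp (ℓ (u + ((m + 1 : ℕ) : ℝ) • v)
          - q (u + ((m + 1 : ℕ) : ℝ) • v) (u + ((m + 1 : ℕ) : ℝ) • v) - (m + 1 : ℕ) * (Q + D))
        ≤ Real.exp (∑ k, p k * (ℓ (w + e (g k)) - q (w + e (g k)) (w + e (g k))
            - m * (Q + D) - c k)) := by
          apply Real.exp_le_exp.2
          -- One more draw costs `Q` for the second moment of the atoms and `D` for the relative
          -- entropy.
          simp only [mul_sub, Finset.sum_sub_distrib, hℓ, ← Finset.sum_mul, hp1, hwv]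
          push_cast
          linarith
      _ ≤ ∑ k, p k * Real.exp (ℓ (w + e (g k)) - q (w + e (g k)) (w + e (g k))
            - m * (Q + D) - c k) := exp_sum_mul_le hp hp1 _
      _ ≤ ∑ k, π (g k) * iteratedSum π e (fun w => Real.exp (ℓ w - q w w)) m (u + e (g k)) := by
          refine Finset.sum_le_sum fun k _ => ?_
          have h₁ := ih (u + e (g k))
          rw [add_right_comm, ← hw] at h₁
          rw [Real.exp_sub, mul_div_assoc', div_le_iff₀ (Real.exp_pos _)]
          calc _ ≤ (π (g k) * Real.exp (c k)) * _ :=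
                mul_le_mul (hpπ k) h₁ (Real.exp_pos _).le ((hp k).trans (hpπ k))
            _ = _ := by ring
      _ ≤ iteratedSum π e (fun w => Real.exp (ℓ w - q w w)) (m + 1) u := by
          classical
          rw [iteratedSum, ← Finset.sum_image (f := fun a => π a *
            iteratedSum π e (fun w => Real.exp (ℓ w - q w w)) m (u + e a)) hg.injOn]
          exact Finset.sum_le_sum_of_subset_of_nonneg (Finset.subset_univ _) fun a _ _ =>
            mul_nonneg (hπ a) (iteratedSum_nonneg hπ e (fun _ => (Real.exp_pos _).le) m _)

end IteratedSum

/-! ### The SLOPE ball as a set of barycentres of finitely many atoms. -/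

section Slope

variable {d : ℕ}

/-- The integer level `⌈log (e d / i)⌉` of the rank `i` (ranks start at `0` in the code). -/
noncomputable def rankLevel (d : ℕ) (i : Fin d) : ℕ := ⌈Real.log (Real.exp 1 * (d : ℝ) / ((i : ℕ) + 1 : ℝ))⌉₊

theorem one_le_log_rank (i : Fin d) :
    1 ≤ Real.log (Real.exp 1 * (d : ℝ) / ((i : ℕ) + 1 : ℝ)) := by
  have hi : ((i : ℕ) + 1 : ℝ) ≤ d := by exact_mod_cast i.2
  have h0 : (0 : ℝ) < (i : ℕ) + 1 := by positivity
  have hd : (0 : ℝ) < d := h0.trans_le hi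
  rw [Real.le_log_iff_exp_le (by positivity), le_div_iff₀ h0]
  gcongr

theorem one_le_rankLevel (i : Fin d) : 1 ≤ rankLevel d i :=
  Nat.one_le_ceil_iff.2 (by linarith [one_le_log_rank i])

theorem rankLevel_antitone : Antitone (rankLevel d) := fun i j hij => by
  have hd : (0 : ℝ) < d := by exact_mod_cast i.pos
  have hij' : ((i : ℕ) : ℝ) ≤ (j : ℕ) := by exact_mod_cast hij
  unfold rankLevel
  gcongr

theorem rankLevel_le (i : Fin d) : rankLevel d i ≤ ⌈Real.log (Real.exp 1 * (d : ℝ))⌉₊ := by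
  have hd : (0 : ℝ) < d := by exact_mod_cast i.pos
  unfold rankLevel
  gcongr
  exact div_le_self (by positivity) (by simp)

theorem div_le_exp_rankLevel (i : Fin d) :
    (d : ℝ) / ((i : ℕ) + 1 : ℝ) ≤ Real.exp (rankLevel d i) := by
  have hd : (0 : ℝ) < d := by exact_mod_cast i.pos
  have h : Real.log (Real.exp 1 * (d : ℝ) / ((i : ℕ) + 1 : ℝ)) ≤ rankLevel d i := Nat.le_ceil _
  rw [Real.log_le_iff_le_exp (by positivity)] at h
  refine le_trans ?_ h
  gcongr
  have := Real.add_one_le_exp (1 : ℝ)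
  nlinarith

/-- Rounding up to an integer level, which keeps the family of atoms finite, costs only a constant
because the logarithm is at least 1. -/
theorem sqrt_rankLevel_le {n : ℕ} (hn : 0 < n) (i : Fin d) :
    Real.sqrt (rankLevel d i) ≤ 2 * Real.sqrt n * slopeWeight n d i := by
  have hn' : (0 : ℝ) < n := by exact_mod_cast hn
  have h1 := one_le_log_rank i
  have h : (rankLevel d i : ℝ) < Real.log (Real.exp 1 * (d : ℝ) / ((i : ℕ) + 1 : ℝ)) + 1 :=
    Nat.ceil_lt_add_one (by linarith)
  have h4 : Real.sqrt 4 = 2 := by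
    rw [show (4 : ℝ) = 2 ^ 2 by norm_num, Real.sqrt_sq (by norm_num)]
  unfold slopeWeight
  rw [← h4, ← Real.sqrt_mul (by norm_num), ← Real.sqrt_mul (by positivity)]
  apply Real.sqrt_le_sqrt
  rw [mul_assoc, mul_div_cancel₀ _ hn'.ne']
  linarith

/-- The level of the coordinate `j` in the decreasing order of the absolute values of `v`. -/
noncomputable def coordLevel (v : EuclideanSpace ℝ (Fin d)) (j : Fin d) : ℕ :=
  rankLevel d ((Tuple.sort fun j => -|v j|).symm j)

theorem one_le_coordLevel (v : EuclideanSpace ℝ (Fin d)) (j : Fin d) : 1 ≤ coordLevel v j :=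
  one_le_rankLevel _

theorem sum_sqrt_coordLevel_le {n : ℕ} (hn : 0 < n) (v : EuclideanSpace ℝ (Fin d)) :
    ∑ j, Real.sqrt (coordLevel v j) * |v j| ≤
      2 * Real.sqrt n * slopeNorm (slopeWeight n d) v := by
  rw [← Equiv.sum_comp (Tuple.sort fun j => -|v j|), slopeNorm, Finset.mul_sum]
  refine Finset.sum_le_sum fun i _ => ?_
  rw [coordLevel, Equiv.symm_apply_apply, ← mul_assoc]
  gcongr
  exact sqrt_rankLevel_le hn i

/-- The entry of rank `i` is dominated by each of the `i` terms up to its rank, so it is at most a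
fraction `1 / i` of the sum, and `d / i ≤ exp (level)`. This bounds the density of the law used
below with respect to `slopeIndexWeight`. -/
theorem abs_mul_sqrt_coordLevel_le (v : EuclideanSpace ℝ (Fin d)) (j : Fin d) :
    d * (Real.sqrt (coordLevel v j) * |v j|) ≤
      Real.exp (coordLevel v j) * ∑ j, Real.sqrt (coordLevel v j) * |v j| := by
  set τ := Tuple.sort fun j => -|v j| with hτ
  obtain ⟨i, rfl⟩ := τ.surjective j
  have hlev : ∀ i, coordLevel v (τ i) = rankLevel d i := fun i => by
    rw [coordLevel, Equiv.symm_apply_apply]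
  have hmono : Monotone ((fun j => -|v j|) ∘ τ) := Tuple.monotone_sort _
  set t := Real.sqrt (rankLevel d i) * |v (τ i)| with ht
  have h0 : 0 ≤ t := by positivity
  have hsum : ((i : ℕ) + 1 : ℝ) * t ≤ ∑ j, Real.sqrt (coordLevel v j) * |v j| := by
    calc ((i : ℕ) + 1 : ℝ) * t = ∑ k ∈ Finset.Iic i, t := by
          rw [Finset.sum_const, Fin.card_Iic, nsmul_eq_mul]; push_cast; ring
      _ ≤ ∑ k ∈ Finset.Iic i, Real.sqrt (coordLevel v (τ k)) * |v (τ k)| := by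
          refine Finset.sum_le_sum fun k hk => ?_
          have hk := Finset.mem_Iic.1 hk
          rw [hlev, ht]
          have h1 : (rankLevel d i : ℝ) ≤ rankLevel d k := by exact_mod_cast rankLevel_antitone hk
          have h2 : |v (τ i)| ≤ |v (τ k)| := by simpa using hmono hk
          exact mul_le_mul (Real.sqrt_le_sqrt h1) h2 (abs_nonneg _) (Real.sqrt_nonneg _)
      _ ≤ ∑ k, Real.sqrt (coordLevel v (τ k)) * |v (τ k)| :=
          Finset.sum_le_sum_of_subset_of_nonneg (Finset.subset_univ _) fun _ _ _ => by positivity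
      _ = _ := Equiv.sum_comp τ fun j => Real.sqrt (coordLevel v j) * |v j|
  have hdiv := div_le_exp_rankLevel i
  have hi : (0 : ℝ) < (i : ℕ) + 1 := by positivity
  rw [hlev]
  calc (d : ℝ) * t = d / ((i : ℕ) + 1) * (((i : ℕ) + 1) * t) := by field_simp
    _ ≤ _ := mul_le_mul hdiv hsum (by positivity) (Real.exp_pos _).le

/-- Indices of the atoms used to represent the vectors of a SLOPE ball. -/
abbrev SlopeIndex (d : ℕ) : Type :=
  Option (Fin d × Fin (⌈Real.log (Real.exp 1 * (d : ℝ))⌉₊ + 1) × Bool)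

/-- The weight of an atom. -/
noncomputable def slopeIndexWeight : SlopeIndex d → ℝ
  | none => 1
  | some (_, l, _) => Real.exp (-(l : ℕ)) / d

/-- The atoms `0` and `± √l a e_j`. -/
noncomputable def slopeAtom (a : ℝ) : SlopeIndex d → EuclideanSpace ℝ (Fin d)
  | none => 0
  | some (j, l, b) => EuclideanSpace.single j ((if b then 1 else -1) * (Real.sqrt (l : ℕ) * a))

theorem slopeIndexWeight_nonneg (a : SlopeIndex d) : 0 ≤ slopeIndexWeight a := by
  rcases a with _ | ⟨j, l, b⟩
  · exact zero_le_one
  · unfold slopeIndexWeight; positivity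

/-- The zero atom contributes 1, and each of the two signs a geometric series of sum at most 2. -/
theorem sum_slopeIndexWeight_le : ∑ a : SlopeIndex d, slopeIndexWeight a ≤ 5 := by
  have hgeo : ∀ m : ℕ, ∑ l : Fin m, Real.exp (-(l : ℕ)) ≤ 2 := fun m => by
    rw [Fin.sum_univ_eq_sum_range (fun l => Real.exp (-(l : ℝ))) m]
    calc ∑ l ∈ Finset.range m, Real.exp (-(l : ℝ)) ≤ ∑ l ∈ Finset.range m, (1 / 2 : ℝ) ^ l := by
          refine Finset.sum_le_sum fun l _ => ?_
          rw [Real.exp_neg, one_div, inv_pow]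
          apply inv_anti₀ (by positivity)
          rw [← Real.exp_one_pow]
          gcongr
          linarith [Real.add_one_le_exp (1 : ℝ)]
      _ ≤ 2 := sum_geometric_two_le m
  rw [Fintype.sum_option]
  simp only [slopeIndexWeight, Fintype.sum_prod_type, Finset.sum_const, Finset.card_univ,
    Fintype.card_bool, nsmul_eq_mul, Fintype.card_fin, ← Finset.sum_div]
  rcases Nat.eq_zero_or_pos d with rfl | hd
  · simp
  have hd' : (0 : ℝ) < d := by exact_mod_cast hd
  have := hgeo (⌈Real.log (Real.exp 1 * (d : ℝ))⌉₊ + 1)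
  rw [← Finset.mul_sum, mul_div_cancel_left₀ _ hd'.ne']
  push_cast
  linarith

/-- The index of the atom carrying the coordinate `j` of `v`. -/
noncomputable def coordIndex (v : EuclideanSpace ℝ (Fin d)) : Option (Fin d) → SlopeIndex d :=
  Option.map fun j =>
    (j, ⟨coordLevel v j, Nat.lt_succ_of_le (rankLevel_le _)⟩, decide (0 ≤ v j))

theorem coordIndex_injective (v : EuclideanSpace ℝ (Fin d)) :
    Function.Injective (coordIndex v) :=
  Option.map_injective fun i j h => by simpa using congrArg Prod.fst h

theorem slopeAtom_coordIndex (v : EuclideanSpace ℝ (Fin d)) (a : ℝ) (j : Fin d) :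
    slopeAtom a (coordIndex v (some j)) =
      EuclideanSpace.single j ((if 0 ≤ v j then 1 else -1) * (Real.sqrt (coordLevel v j) * a)) := by
  simp [slopeAtom, coordIndex]

/-- A vector of a SLOPE ball as the barycentre of `n` copies of a law on the atoms: lower bound on
the iterated sum of the exponential of a concave quadratic function. -/
theorem exp_le_iteratedSum_slopeAtom {n : ℕ} (hn : 0 < n) {T ρ κ : ℝ} (hT : 0 < T) (hκ : 0 ≤ κ)
    {S : Matrix (Fin d) (Fin d) ℝ} (hS : ∀ w, 0 ≤ matBilin S w w) (hρ : ∀ j, S j j ≤ ρ ^ 2)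
    {v : EuclideanSpace ℝ (Fin d)} (hv : 2 * Real.sqrt n * slopeNorm (slopeWeight n d) v ≤ T)
    (ℓ : EuclideanSpace ℝ (Fin d) →ₗ[ℝ] ℝ) :
    Real.exp (ℓ v - κ * matBilin S v v - (κ * ρ ^ 2 * T ^ 2 / n + 2 * n)) ≤
      iteratedSum slopeIndexWeight (slopeAtom (T / n))
        (fun w => Real.exp (ℓ w - κ * matBilin S w w)) n 0 := by
  have hn' : (0 : ℝ) < n := by exact_mod_cast hn
  have hlev : ∀ j, (1 : ℝ) ≤ coordLevel v j := fun j => by exact_mod_cast one_le_coordLevel v j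
  have hsq : ∀ j, Real.sqrt (coordLevel v j) * Real.sqrt (coordLevel v j) = coordLevel v j :=
    fun j => Real.mul_self_sqrt (by positivity)
  have hpos : ∀ j, 0 < Real.sqrt (coordLevel v j) := fun j =>
    Real.sqrt_pos.2 (by linarith [hlev j])
  have hsum : ∑ j, Real.sqrt (coordLevel v j) * |v j| ≤ T := (sum_sqrt_coordLevel_le hn v).trans hv
  -- The mass of the atom `± √l (T / n) e_j` that makes the mean equal to `v / n`; the leftover mass
  -- goes to the zero atom. As `∑ w j * l j ≤ 1`, the log-density bound `2 * l j` averages to at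
  -- most 2, and the second moment is at most `ρ ^ 2 * (T / n) ^ 2`.
  set w : Fin d → ℝ := fun j => |v j| / (Real.sqrt (coordLevel v j) * T) with hw
  have hw0 : ∀ j, 0 ≤ w j := fun j => by positivity
  have hwl : ∀ j, w j * coordLevel v j = Real.sqrt (coordLevel v j) * |v j| / T := fun j => by
    rw [hw]
    dsimp only
    nth_rw 2 [← hsq j]
    have := (hpos j).ne'
    field_simp
  have hwlsum : ∑ j, w j * coordLevel v j ≤ 1 := by
    simp_rw [hwl]
    rw [← Finset.sum_div, div_le_one hT]
    exact hsum
  have hwsum : ∑ j, w j ≤ 1 := le_trans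
    (Finset.sum_le_sum fun j _ => le_mul_of_one_le_right (hw0 j) (hlev j)) hwlsum
  have main := exp_le_iteratedSum (ι := SlopeIndex d) (κ := Option (Fin d))
    (π := slopeIndexWeight) slopeIndexWeight_nonneg (slopeAtom (T / n)) (coordIndex v)
    (coordIndex_injective v)
    (p := fun k => k.elim (1 - ∑ j, w j) w) (c := fun k => k.elim 0 fun j => 2 * coordLevel v j)
    (D := 2) (v := (1 / n : ℝ) • v) (Q := κ * (ρ ^ 2 * (T / n) ^ 2))
    (by rintro (_ | j)
        · simpa using hwsum
        · exact hw0 j)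
    (by simp [Fintype.sum_option])
    (by rintro (_ | j)
        · have := Finset.sum_nonneg fun j (_ : j ∈ Finset.univ) => hw0 j
          simpa [slopeIndexWeight, coordIndex] using this
        · have hd : (0 : ℝ) < d := by exact_mod_cast j.pos
          simp only [Option.elim, coordIndex, Option.map_some, slopeIndexWeight]
          rw [div_mul_eq_mul_div, ← Real.exp_add, le_div_iff₀ hd,
            show -(coordLevel v j : ℝ) + 2 * coordLevel v j = coordLevel v j by ring]
          have h1 := (abs_mul_sqrt_coordLevel_le v j).trans
            (mul_le_mul_of_nonneg_left hsum (Real.exp_pos _).le)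
          have h2 := le_mul_of_one_le_right (hw0 j) (hlev j)
          rw [hwl] at h2
          calc w j * d ≤ Real.sqrt (coordLevel v j) * |v j| / T * d := by gcongr
            _ = d * (Real.sqrt (coordLevel v j) * |v j|) / T := by ring
            _ ≤ Real.exp (coordLevel v j) := by rwa [div_le_iff₀ hT])
    (by rw [Fintype.sum_option]
        simp only [Option.elim, mul_zero, zero_add]
        calc ∑ j, w j * (2 * coordLevel v j) = 2 * ∑ j, w j * coordLevel v j := by
              rw [Finset.mul_sum]
              exact Finset.sum_congr rfl fun j _ => by ring
          _ ≤ 2 := by linarith)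
    (by rw [Fintype.sum_option]
        simp only [Option.elim, slopeAtom_coordIndex]
        ext i
        simp only [coordIndex, Option.map_none, slopeAtom, smul_zero, zero_add, PiLp.smul_apply,
          WithLp.ofLp_sum, Finset.sum_apply, smul_eq_mul, PiLp.single_apply, mul_ite, mul_zero,
          Finset.sum_ite_eq, Finset.mem_univ, if_true]
        have := (hpos i).ne'
        have habs : |v i| * (if 0 ≤ v i then 1 else -1) = v i := by
          split_ifs with h
          · rw [abs_of_nonneg h, mul_one]
          · rw [abs_of_neg (not_le.1 h)]; ring
        rw [hw]
        dsimp only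
        conv_rhs => rw [← habs]
        field_simp)
    ℓ (κ • matBilin S) (fun w => mul_nonneg hκ (hS w))
    (by rw [Fintype.sum_option]
        simp only [Option.elim, slopeAtom_coordIndex, LinearMap.smul_apply, matBilin_single,
          smul_eq_mul]
        simp only [coordIndex, Option.map_none, slopeAtom, map_zero, mul_zero, zero_add]
        have hite : ∀ j, ((if 0 ≤ v j then (1 : ℝ) else -1) * (Real.sqrt (coordLevel v j)
            * (T / n))) ^ 2 = coordLevel v j * (T / n) ^ 2 := fun j => by
          rw [mul_pow, mul_pow, Real.sq_sqrt (by positivity)]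
          split_ifs <;> norm_num
        simp_rw [hite]
        calc ∑ j, w j * (κ * (coordLevel v j * (T / n) ^ 2 * S j j))
            ≤ ∑ j, κ * (ρ ^ 2 * (T / n) ^ 2) * (w j * coordLevel v j) := by
              refine Finset.sum_le_sum fun j _ => ?_
              have h1 : 0 ≤ w j * κ * (coordLevel v j * (T / n) ^ 2) := by
                have := hw0 j
                positivity
              nlinarith [mul_le_mul_of_nonneg_left (hρ j) h1]
          _ = κ * (ρ ^ 2 * (T / n) ^ 2) * ∑ j, w j * coordLevel v j := by rw [Finset.mul_sum]
          _ ≤ κ * (ρ ^ 2 * (T / n) ^ 2) := mul_le_of_le_one_right (by positivity) hwlsum)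
    n 0
  simp only [zero_add, smul_smul, mul_one_div_cancel hn'.ne', one_smul, LinearMap.smul_apply,
    smul_eq_mul] at main
  convert main using 3
  field_simp

end Slope

/-! ### Uniform deviation bound over `Vmean`. -/

section UniformBound

variable {d : ℕ}

theorem eq_zero_of_slopeNorm_nonpos {n : ℕ} (hn : 0 < n) {v : EuclideanSpace ℝ (Fin d)}
    (hv : slopeNorm (slopeWeight n d) v ≤ 0) : v = 0 := by
  have h := sum_sqrt_coordLevel_le hn v
  have h0 : ∑ j, Real.sqrt (coordLevel v j) * |v j| ≤ 0 :=
    h.trans (mul_nonpos_of_nonneg_of_nonpos (by positivity) hv)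
  have h1 := (Finset.sum_eq_zero_iff_of_nonneg fun j _ => by positivity).1
    (h0.antisymm (Finset.sum_nonneg fun j _ => by positivity))
  ext j
  have hj := h1 j (Finset.mem_univ j)
  have hpos : 0 < Real.sqrt (coordLevel v j) :=
    Real.sqrt_pos.2 (by exact_mod_cast one_le_coordLevel v j)
  simpa [hpos.ne'] using hj

/-- Uniform bound over `V_mean` for the sum of the covariates over a set `I` of indices that makes
up a fixed fraction of the sample. -/
theorem measure_exists_lt_inner_sum_le {Ω : Type*} [MeasurableSpace Ω] {P : Measure Ω}
    [IsProbabilityMeasure P] {n : ℕ} (hn : 0 < n) {L ρ σ r R : ℝ} (hL : 0 < L) (hρ0 : 0 < ρ)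
    (hσ : 0 ≤ σ) (hr : 0 ≤ r) (hR : 0 ≤ R) (hρR : ρ * R ≤ 1)
    {ν : Measure (EuclideanSpace ℝ (Fin d))} {x : Fin n → Ω → EuclideanSpace ℝ (Fin d)}
    (hx : iIndepFun x P) (hlaw : ∀ i, HasLaw (x i) ν P) (hν : IsSubGaussianLaw L ν)
    (hρ : ∀ j, covMat ν j j ≤ ρ ^ 2) (I : Finset (Fin n)) (hI : n ≤ 16 * I.card) :
    P {ω | ∃ v ∈ Vmean n ν σ r R, I.card * (101 * (L * (σ * r))) < inner ℝ (∑ i ∈ I, x i ω) v} ≤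
      ENNReal.ofReal (Real.exp (-2 * n)) := by
  have hn' : (0 : ℝ) < n := by exact_mod_cast hn
  have : IsProbabilityMeasure ν := by
    rw [← (hlaw ⟨0, hn⟩).map_eq]
    exact Measure.isProbabilityMeasure_map (hlaw ⟨0, hn⟩).aemeasurable
  have hI' : (n : ℝ) ≤ 16 * I.card := by exact_mod_cast hI
  -- If `σ * r * R = 0`, only `v = 0` is left; otherwise `s` and `T` below are positive.
  rcases (mul_nonneg (mul_nonneg hσ hr) hR).eq_or_lt with h0 | hpos
  · refine (measure_mono_null (t := ∅) ?_ measure_empty).trans_le zero_le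
    rintro ω ⟨v, hv, hlt⟩
    exfalso
    have : v = 0 := eq_zero_of_slopeNorm_nonpos hn (hv.2.trans (by nlinarith))
    rw [this, inner_zero_right] at hlt
    have : 0 ≤ I.card * (101 * (L * (σ * r))) := by positivity
    linarith
  set s := σ * r with hs
  have hs0 : 0 < s := pos_of_mul_pos_left hpos hR
  -- This scale makes `κ * s ^ 2 = |I|`, so that every quadratic term is of order `|I|`.
  set t := 1 / (L * s) with ht
  set κ := I.card * t ^ 2 * L ^ 2 with hκ
  have hκ0 : 0 ≤ κ := by positivity
  have hκs : κ * s ^ 2 = I.card := by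
    rw [hκ, ht]
    field_simp
  set T := 2 * Real.sqrt n * (s * R) with hT
  have hT0 : 0 < T := by positivity
  have hρT : ρ ^ 2 * T ^ 2 / n ≤ 4 * s ^ 2 := by
    rw [hT, mul_pow, mul_pow, Real.sq_sqrt hn'.le, div_le_iff₀ hn']
    have h1 : (ρ * R) ^ 2 ≤ 1 := pow_le_one₀ (by positivity) hρR
    have h2 : 0 ≤ 4 * n * s ^ 2 := by positivity
    nlinarith [mul_le_mul_of_nonneg_left h1 h2]
  set F : Ω → EuclideanSpace ℝ (Fin d) → ℝ := fun ω w =>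
    Real.exp (t * inner ℝ (∑ i ∈ I, x i ω) w - κ * matBilin (covMat ν) w w) with hF
  set Z : Ω → ℝ := fun ω => iteratedSum slopeIndexWeight (slopeAtom (T / n)) (F ω) n 0 with hZ
  have hFm : ∀ u, AEMeasurable (fun ω => F ω u) P := fun u => by
    have : AEMeasurable (fun ω => ∑ i ∈ I, x i ω) P :=
      Finset.aemeasurable_fun_sum _ fun i _ => (hlaw i).aemeasurable
    fun_prop
  have hZm : AEMeasurable (fun ω => ENNReal.ofReal (Z ω)) P :=
    (aemeasurable_iteratedSum _ _ hFm n 0).ennreal_ofReal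
  have hEZ : ∫⁻ ω, ENNReal.ofReal (Z ω) ∂P ≤ ENNReal.ofReal (Real.exp (2 * n)) := by
    refine (lintegral_iteratedSum_le slopeIndexWeight_nonneg _ hFm (fun _ _ => (Real.exp_pos _).le)
      (fun u => hν.lintegral_exp_sum_le hL.le hx hlaw I t u) n 0).trans ?_
    rw [← ENNReal.ofReal_pow (Finset.sum_nonneg fun a _ => slopeIndexWeight_nonneg a)]
    apply ENNReal.ofReal_le_ofReal
    rw [mul_comm (2 : ℝ), Real.exp_nat_mul]
    have h5 : (5 : ℝ) ≤ Real.exp 2 := by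
      have := Real.quadratic_le_exp_of_nonneg (x := 2) (by norm_num)
      linarith
    exact pow_le_pow_left₀ (Finset.sum_nonneg fun a _ => slopeIndexWeight_nonneg a)
      (sum_slopeIndexWeight_le.trans h5) n
  -- The exponent is at least `101 |I| - |I| - 4 |I| - 2 n`, which is at least `4 n` because `16 |I|
  -- ≥ n`. This fixes the constant 101.
  have hsub : {ω | ∃ v ∈ Vmean n ν σ r R, I.card * (101 * (L * s)) < inner ℝ (∑ i ∈ I, x i ω) v} ⊆
      {ω | ENNReal.ofReal (Real.exp (4 * n)) ≤ ENNReal.ofReal (Z ω)} := by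
    rintro ω ⟨v, hv, hlt⟩
    refine ENNReal.ofReal_le_ofReal (le_trans (Real.exp_le_exp.2 ?_)
      (exp_le_iteratedSum_slopeAtom hn hT0 hκ0 hν.matBilin_self_nonneg hρ (v := v) ?_
        (t • (innerSL ℝ (∑ i ∈ I, x i ω)).toLinearMap)))
    · have hq : matBilin (covMat ν) v v ≤ s ^ 2 := by
        have h := hv.1
        rw [matNorm, Real.sqrt_le_left hs0.le] at h
        exact h
      have h1 : κ * matBilin (covMat ν) v v ≤ I.card := by
        rw [← hκs]
        gcongr
      have h2 : κ * ρ ^ 2 * T ^ 2 / n ≤ 4 * I.card := by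
        rw [← hκs]
        calc κ * ρ ^ 2 * T ^ 2 / n = κ * (ρ ^ 2 * T ^ 2 / n) := by ring
          _ ≤ κ * (4 * s ^ 2) := by gcongr
          _ = 4 * (κ * s ^ 2) := by ring
      have h3 : (I.card * 101 : ℝ) ≤ t * inner ℝ (∑ i ∈ I, x i ω) v := by
        have := mul_le_mul_of_nonneg_left hlt.le (show 0 ≤ t by positivity)
        refine le_trans (le_of_eq ?_) this
        rw [ht]
        field_simp
      have h4 : (t • (innerSL ℝ (∑ i ∈ I, x i ω)).toLinearMap) v
          = t * inner ℝ (∑ i ∈ I, x i ω) v := rfl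
      rw [h4]
      linarith
    · rw [hT]
      have h := hv.2
      have : σ * R * r = s * R := by rw [hs]; ring
      rw [this] at h
      gcongr
  have hmarkov := mul_meas_ge_le_lintegral₀ hZm (ENNReal.ofReal (Real.exp (4 * n)))
  have h4 : ENNReal.ofReal (Real.exp (4 * n)) ≠ 0 := by simp [Real.exp_pos]
  calc P _ ≤ P {ω | ENNReal.ofReal (Real.exp (4 * n)) ≤ ENNReal.ofReal (Z ω)} :=
        measure_mono hsub
    _ ≤ ENNReal.ofReal (Real.exp (2 * n)) / ENNReal.ofReal (Real.exp (4 * n)) := by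
        rw [ENNReal.le_div_iff_mul_le (Or.inl h4) (Or.inl ENNReal.ofReal_ne_top), mul_comm]
        exact hmarkov.trans hEZ
    _ = ENNReal.ofReal (Real.exp (-2 * n)) := by
        rw [← ENNReal.ofReal_div_of_pos (Real.exp_pos _), ← Real.exp_sub]
        congr 2
        ring

end UniformBound

/-! ### Blocks and medians. -/

section Blocks

/-- The indices of the `k`-th block of length `N`. -/
def blockSet (n N k : ℕ) : Finset (Fin n) :=
  Finset.univ.filter fun i => k * N ≤ i.val ∧ i.val < (k + 1) * N

theorem mem_blockSet {n N k : ℕ} {i : Fin n} :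
    i ∈ blockSet n N k ↔ k * N ≤ i.val ∧ i.val < (k + 1) * N := by
  simp [blockSet]

theorem div_eq_of_mem_blockSet {n N k : ℕ} {i : Fin n} (h : i ∈ blockSet n N k) :
    i.val / N = k :=
  Nat.div_eq_of_lt_le (mem_blockSet.1 h).1 (mem_blockSet.1 h).2

theorem pairwise_disjoint_blockSet (n N : ℕ) {k l : ℕ} (hkl : k ≠ l) :
    Disjoint (blockSet n N k) (blockSet n N l) :=
  Finset.disjoint_left.2 fun _ hk hl =>
    hkl ((div_eq_of_mem_blockSet hk).symm.trans (div_eq_of_mem_blockSet hl))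

theorem card_blockSet {n B N k : ℕ} (hn : B * N = n) (hk : k < B) :
    (blockSet n N k).card = N := by
  have hle : (k + 1) * N ≤ n := hn ▸ Nat.mul_le_mul_right N hk
  have : (blockSet n N k).map Fin.valEmbedding = Finset.Ico (k * N) ((k + 1) * N) := by
    ext m
    simp only [Finset.mem_map, mem_blockSet, Fin.valEmbedding_apply, Finset.mem_Ico]
    exact ⟨fun ⟨i, hi, him⟩ => him ▸ hi, fun hm => ⟨⟨m, by omega⟩, hm, rfl⟩⟩
  rw [← Finset.card_map Fin.valEmbedding, this, Nat.card_Ico, add_mul, one_mul,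
    Nat.add_sub_cancel_left]

/-- If fewer than half of the entries are further than `t` from `μ`, so is no median. -/
theorem IsMedian.abs_sub_le {B : ℕ} {a : Fin B → ℝ} {m μ t : ℝ} (h : IsMedian a m)
    (hbad : 2 * (Finset.univ.filter fun k => t < |a k - μ|).card < B) : |m - μ| ≤ t := by
  by_contra! hm
  rcases lt_abs.1 hm with h1 | h1
  · have : (Finset.univ.filter fun k => m ≤ a k).card ≤
        (Finset.univ.filter fun k => t < |a k - μ|).card := by
      refine Finset.card_le_card fun k hk => ?_
      simp only [Finset.mem_filter, Finset.mem_univ, true_and] at hk ⊢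
      exact lt_abs.2 (Or.inl (by linarith))
    have := h.2
    omega
  · have : (Finset.univ.filter fun k => a k ≤ m).card ≤
        (Finset.univ.filter fun k => t < |a k - μ|).card := by
      refine Finset.card_le_card fun k hk => ?_
      simp only [Finset.mem_filter, Finset.mem_univ, true_and] at hk ⊢
      exact lt_abs.2 (Or.inr (by linarith))
    have := h.1
    omega

theorem card_filter_exists_mem_blockSet_le {n : ℕ} (B N : ℕ) (S : Finset (Fin n)) :
    (Finset.univ.filter fun k : Fin B => ∃ i ∈ S, i ∈ blockSet n N k).card ≤ S.card := by
  rw [← Finset.card_map Fin.valEmbedding]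
  refine (Finset.card_le_card (t := S.image fun i => i.val / N) fun m hm => ?_).trans
    Finset.card_image_le
  obtain ⟨k, hk, rfl⟩ := Finset.mem_map.1 hm
  obtain ⟨i, hi, hik⟩ := (Finset.mem_filter.1 hk).2
  exact Finset.mem_image.2 ⟨i, hi, div_eq_of_mem_blockSet hik⟩

end Blocks

/-! ### Independent blocks, union bound and Chebyshev's inequality. -/

section Probability

variable {Ω : Type*} [MeasurableSpace Ω] {P : Measure Ω}

/-- Sums over disjoint blocks of independent variables: the probability that all of them are large
is at most the product of the bounds. -/
theorem measure_forall_lt_abs_sum_le {ι J : Type*} [IsProbabilityMeasure P] {ξ : J → Ω → ℝ}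
    (hξ : iIndepFun ξ P) (hm : ∀ i, AEMeasurable (ξ i) P) {b : ι → Finset J}
    (hb : Pairwise fun k l => Disjoint (b k) (b l)) (t : ℝ) (p : ℝ≥0∞)
    (hp : ∀ k, P {ω | t < |∑ i ∈ b k, ξ i ω|} ≤ p) (K : Finset ι) :
    P {ω | ∀ k ∈ K, t < |∑ i ∈ b k, ξ i ω|} ≤ p ^ K.card := by
  classical
  induction K using Finset.induction_on with
  | empty => simp
  | insert k K hk ih =>
    set U := K.biUnion b with hU
    have hdisj : Disjoint (b k) U := by
      rw [hU, Finset.disjoint_biUnion_right]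
      exact fun l hl => hb fun hkl => hk (hkl ▸ hl)
    have hind := hξ.indepFun_finset₀ (b k) U hdisj hm
    set A : Set (b k → ℝ) := {g | t < |∑ i, g i|} with hA
    -- Functions on `U` are extended by 0; the default is never reached, since every `b l` with `l ∈
    -- K` lies in `U`.
    set C : Set (U → ℝ) :=
      {g | ∀ l ∈ K, t < |∑ i ∈ b l, if h : i ∈ U then g ⟨i, h⟩ else 0|} with hC
    have hAm : MeasurableSet A := measurableSet_lt (by fun_prop) (by fun_prop)
    have hCm : MeasurableSet C := by
      have : C = ⋂ l ∈ K, {g | t < |∑ i ∈ b l, if h : i ∈ U then g ⟨i, h⟩ else 0|} := by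
        ext g; simp [hC]
      rw [this]
      refine Finset.measurableSet_biInter _ fun l _ => measurableSet_lt measurable_const ?_
      refine measurable_norm.comp (Finset.measurable_fun_sum (M := ℝ) _ fun i _ => ?_)
      by_cases h : i ∈ U
      · simp only [h, dif_pos]; fun_prop
      · simp only [h, dif_neg, not_false_eq_true]; fun_prop
    have hA' : (fun ω (i : b k) => ξ i ω) ⁻¹' A = {ω | t < |∑ i ∈ b k, ξ i ω|} := by
      ext ω
      simp only [hA, Set.mem_preimage, Set.mem_ofPred_eq]
      rw [Finset.sum_coe_sort (b k) fun i => ξ i ω]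
    have hC' : (fun ω (i : U) => ξ i ω) ⁻¹' C = {ω | ∀ l ∈ K, t < |∑ i ∈ b l, ξ i ω|} := by
      ext ω
      simp only [hC, Set.mem_preimage, Set.mem_ofPred_eq]
      refine forall₂_congr fun l hl => ?_
      rw [Finset.sum_congr rfl fun i hi => dif_pos (Finset.mem_biUnion.2 ⟨l, hl, hi⟩)]
    have hinter : {ω | ∀ l ∈ insert k K, t < |∑ i ∈ b l, ξ i ω|} =
        (fun ω (i : b k) => ξ i ω) ⁻¹' A ∩ (fun ω (i : U) => ξ i ω) ⁻¹' C := by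
      rw [hA', hC']
      ext ω
      simp
    rw [hinter, hind.measure_inter_preimage_eq_mul _ _ hAm hCm, hA', hC',
      Finset.card_insert_of_notMem hk, pow_succ']
    exact mul_le_mul' (hp k) ih

/-- Union bound over the subsets of `Fin B`. -/
theorem measure_iUnion_finset_le {B : ℕ} {A : Finset (Fin B) → Set Ω}
    (hA : ∀ K, P (A K) ≤ ENNReal.ofReal (Real.exp (-2 * B))) :
    P (⋃ K, A K) ≤ ENNReal.ofReal (Real.exp (-B)) := by
  calc P (⋃ K, A K) ≤ ∑ K, P (A K) := measure_iUnion_fintype_le P A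
    _ ≤ ∑ _K : Finset (Fin B), ENNReal.ofReal (Real.exp (-2 * B)) :=
        Finset.sum_le_sum fun K _ => hA K
    _ = ENNReal.ofReal (2 ^ B * Real.exp (-2 * B)) := by
        rw [Finset.sum_const, Finset.card_univ, Fintype.card_finset, Fintype.card_fin, nsmul_eq_mul,
          ENNReal.ofReal_mul (by positivity), ENNReal.ofReal_pow (by norm_num)]
        simp
    _ ≤ ENNReal.ofReal (Real.exp (-B)) := by
        apply ENNReal.ofReal_le_ofReal
        have h2 : (2 : ℝ) ≤ Real.exp 1 := by linarith [Real.add_one_le_exp (1 : ℝ)]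
        calc (2 : ℝ) ^ B * Real.exp (-2 * B) ≤ Real.exp 1 ^ B * Real.exp (-2 * B) := by gcongr
          _ = Real.exp (-B) := by
              rw [Real.exp_one_pow, ← Real.exp_add]
              congr 1
              ring

/-- Chebyshev's inequality for a sum of independent centred variables of variance `σ²`. -/
theorem measure_lt_abs_sum_le {J : Type*} [IsProbabilityMeasure P] {ξ : J → Ω → ℝ}
    (hξ : iIndepFun ξ P) (hL2 : ∀ i, MemLp (ξ i) 2 P) (hmean : ∀ i, ∫ ω, ξ i ω ∂P = 0) {σ : ℝ}
    (hσ : 0 ≤ σ) (hvar : ∀ i, ∫ ω, |ξ i ω| ^ 2 ∂P = σ ^ 2) (I : Finset J) :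
    P {ω | Real.exp 8 * σ * Real.sqrt I.card < |∑ i ∈ I, ξ i ω|} ≤
      ENNReal.ofReal (Real.exp (-16)) := by
  set X : Ω → ℝ := fun ω => ∑ i ∈ I, ξ i ω with hX
  have hXeq : X = ∑ i ∈ I, ξ i := by ext ω; simp [hX]
  have hX2 : MemLp X 2 P := memLp_finsetSum _ fun i _ => hL2 i
  have hX0 : ∫ ω, X ω ∂P = 0 := by
    rw [hX, integral_finsetSum _ fun i _ => (hL2 i).integrable (by norm_num)]
    simp [hmean]
  have hV : Var[X; P] = I.card * σ ^ 2 := by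
    rw [hXeq, IndepFun.variance_sum (fun i _ => hL2 i)
      (fun i _ j _ hij => hξ.indepFun hij)]
    rw [Finset.sum_congr rfl fun i _ => ?_, Finset.sum_const, nsmul_eq_mul]
    rw [variance_of_integral_eq_zero (hL2 i).aemeasurable (hmean i), ← hvar i]
    simp
  -- At variance zero Chebyshev's inequality is void; the sum then vanishes almost surely, and the
  -- strict inequality in the event matters.
  rcases (mul_nonneg hσ (Real.sqrt_nonneg (I.card : ℝ))).eq_or_lt with h0 | hpos
  · have hV0 : Var[X; P] = 0 := by
      rw [hV, ← Real.sq_sqrt (Nat.cast_nonneg I.card), ← mul_pow, mul_comm, ← h0]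
      ring
    have hae := ae_eq_integral_of_variance_eq_zero hX2 hV0
    rw [hX0] at hae
    have hzero : P {ω | Real.exp 8 * σ * Real.sqrt I.card < |X ω|} = 0 := by
      refine measure_mono_null (fun ω hω => ?_) (ae_iff.1 hae)
      rw [Set.mem_ofPred_eq, mul_assoc, ← h0, mul_zero] at hω
      exact abs_pos.1 hω
    exact hzero.le.trans zero_le
  · have hc : 0 < Real.exp 8 * σ * Real.sqrt I.card := by
      rw [mul_assoc]; positivity
    have := meas_ge_le_variance_div_sq hX2 hc
    rw [hX0] at this
    simp only [sub_zero] at this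
    refine (measure_mono fun ω hω => ?_).trans (this.trans_eq ?_)
    · simp only [Set.mem_ofPred_eq] at hω ⊢
      exact hω.le
    · congr 1
      rw [hV, mul_assoc, mul_pow, mul_pow, Real.sq_sqrt (Nat.cast_nonneg _), mul_comm (I.card : ℝ),
        ← Real.exp_nat_mul]
      have : σ ^ 2 * I.card ≠ 0 := by
        rw [← Real.sq_sqrt (Nat.cast_nonneg I.card), ← mul_pow]
        positivity
      rw [div_mul_cancel_right₀ this, ← Real.exp_neg]
      norm_num

end Probability

/-! ### Counting bad blocks, and the rate. -/

section Assembly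

/-- The block means of the residuals are close to the intercept on most blocks, as soon as the noise
and the covariates behave well on most blocks and few blocks contain an outlier. -/
theorem abs_sub_le_of_isInterceptEstimate {n d B N : ℕ} (hN : 0 < N) {y ξ θ : Fin n → ℝ}
    {x : Fin n → EuclideanSpace ℝ (Fin d)} {Out : Finset (Fin n)}
    {βstar βhat : EuclideanSpace ℝ (Fin d)} {μstar μhat a c t : ℝ} (hn : B * N = n)
    (hOut : 8 * Out.card ≤ B) (hθ : ∀ i ∉ Out, θ i = 0)
    (hy : ∀ i, y i = inner ℝ (x i) βstar + μstar + a * θ i + ξ i)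
    (hξ : 8 * (Finset.univ.filter fun k : Fin B => c < |∑ i ∈ blockSet n N k, ξ i|).card < B)
    (hx : 16 * (Finset.univ.filter fun k : Fin B =>
      N * t < ∑ i ∈ blockSet n N k, inner ℝ (x i) (βhat - βstar)).card < B)
    (hx' : 16 * (Finset.univ.filter fun k : Fin B =>
      N * t < ∑ i ∈ blockSet n N k, inner ℝ (x i) (-(βhat - βstar))).card < B)
    (hμ : IsInterceptEstimate B N y x βhat μhat) : |μhat - μstar| ≤ c / N + t := by
  have hN' : (0 : ℝ) < N := by exact_mod_cast hN
  apply IsMedian.abs_sub_le hμ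
  have hO := card_filter_exists_mem_blockSet_le B N Out
  set S₀ := Finset.univ.filter fun k : Fin B => ∃ i ∈ Out, i ∈ blockSet n N k
  set S₁ := Finset.univ.filter fun k : Fin B => c < |∑ i ∈ blockSet n N k, ξ i|
  set S₂ := Finset.univ.filter fun k : Fin B =>
      N * t < ∑ i ∈ blockSet n N k, inner ℝ (x i) (βhat - βstar)
  set S₃ := Finset.univ.filter fun k : Fin B =>
      N * t < ∑ i ∈ blockSet n N k, inner ℝ (x i) (-(βhat - βstar))
  have hsub : (Finset.univ.filter fun k : Fin B => c / N + t <
      |blockMean N (fun i => y i - inner ℝ (x i) βhat) k - μstar|) ⊆ (S₀ ∪ S₁) ∪ (S₂ ∪ S₃) := by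
    intro k hk
    by_contra hkS
    simp only [Finset.mem_union, not_or] at hkS
    obtain ⟨⟨h₀, h₁⟩, h₂, h₃⟩ := hkS
    simp only [S₀, S₁, S₂, S₃, Finset.mem_filter, Finset.mem_univ, true_and, not_lt, not_exists,
      not_and] at h₀ h₁ h₂ h₃ hk
    have hmean : blockMean N (fun i => y i - inner ℝ (x i) βhat) k - μstar =
        (∑ i ∈ blockSet n N k, ξ i - ∑ i ∈ blockSet n N k, inner ℝ (x i) (βhat - βstar)) / N := by
      have hres : ∀ i ∈ blockSet n N k, y i - inner ℝ (x i) βhat =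
          μstar + (ξ i - inner ℝ (x i) (βhat - βstar)) := fun i hi => by
        rw [hy, hθ i fun hio => h₀ i hio hi, inner_sub_right]
        ring
      have hcard := card_blockSet hn k.2
      rw [blockMean, ← blockSet, Finset.sum_congr rfl hres, Finset.sum_add_distrib,
        Finset.sum_const, hcard, nsmul_eq_mul, Finset.sum_sub_distrib]
      field_simp
      ring
    rw [hmean, abs_div, abs_of_pos hN', lt_div_iff₀ hN', add_mul, div_mul_cancel₀ _ hN'.ne'] at hk
    simp only [inner_neg_right, Finset.sum_neg_distrib] at h₃
    have h₄ : |∑ i ∈ blockSet n N k, inner ℝ (x i) (βhat - βstar)| ≤ N * t := abs_le'.2 ⟨h₂, h₃⟩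
    have h₅ := abs_sub (∑ i ∈ blockSet n N k, ξ i)
      (∑ i ∈ blockSet n N k, inner ℝ (x i) (βhat - βstar))
    linarith
  -- The four kinds of bad blocks number fewer than `B/8 + B/8 + B/16 + B/16 = 3B/8`, less than
  -- half.
  have hcard := Finset.card_le_card hsub
  have := Finset.card_union_le (S₀ ∪ S₁) (S₂ ∪ S₃)
  have := Finset.card_union_le S₀ S₁
  have := Finset.card_union_le S₂ S₃
  omega

theorem neg_mem_Vmean {d n : ℕ} {ν : Measure (EuclideanSpace ℝ (Fin d))} {σ r R : ℝ}
    {v : EuclideanSpace ℝ (Fin d)} (hv : v ∈ Vmean n ν σ r R) : -v ∈ Vmean n ν σ r R := by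
  refine ⟨?_, ?_⟩
  · simpa [matNorm, Matrix.mulVec_neg] using hv.1
  · simpa [slopeNorm] using hv.2

/-- If every large union of blocks has a small covariate sum in the direction `v`, then few blocks
have a large one. -/
theorem card_filter_lt_of_forall_sum_le {n d B N : ℕ} (hB : 0 < B)
    {x : Fin n → EuclideanSpace ℝ (Fin d)} {v : EuclideanSpace ℝ (Fin d)} {t : ℝ}
    (h : ∀ K : Finset (Fin B), B ≤ 16 * K.card →
      inner ℝ (∑ i ∈ K.biUnion fun k => blockSet n N k, x i) v ≤ (K.card * N : ℕ) * t) :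
    16 * (Finset.univ.filter fun k : Fin B =>
      N * t < ∑ i ∈ blockSet n N k, inner ℝ (x i) v).card < B := by
  by_contra! hcon
  set K := Finset.univ.filter fun k : Fin B => N * t < ∑ i ∈ blockSet n N k, inner ℝ (x i) v with hK
  have hne : K.Nonempty := Finset.card_pos.1 (by omega)
  have hle := h K hcon
  rw [Finset.sum_biUnion fun k _ l _ hkl =>
    pairwise_disjoint_blockSet n N (Fin.val_injective.ne hkl), sum_inner] at hle
  have hlt : ∑ _k ∈ K, N * t < ∑ k ∈ K, ∑ i ∈ blockSet n N k, inner ℝ (x i) v :=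
    Finset.sum_lt_sum_of_nonempty hne fun k hk => (Finset.mem_filter.1 hk).2
  simp only [sum_inner] at hle
  rw [Finset.sum_const, nsmul_eq_mul] at hlt
  push_cast at hle
  linarith

theorem card_biUnion_blockSet {n B N : ℕ} (hn : B * N = n) (K : Finset (Fin B)) :
    (K.biUnion fun k => blockSet n N k).card = K.card * N := by
  rw [Finset.card_biUnion fun k _ l _ hkl =>
    pairwise_disjoint_blockSet n N (Fin.val_injective.ne hkl),
    Finset.sum_congr rfl fun k _ => card_blockSet hn k.2, Finset.sum_const, smul_eq_mul]

/-- The rate: `σ / √N` in terms of the number of outliers and the confidence level. -/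
theorem sqrt_div_le_of_eq_ceil {n B N : ℕ} {O δ : ℝ} (hn0 : 0 < n) (hn : B * N = n) (hO : 0 ≤ O)
    (hδ0 : 0 < δ) (hδ : δ ≤ 1 / 9)
    (hB : B = ⌈max (128 * Real.log (1 / δ)) (8 * O)⌉₊) :
    Real.sqrt N / N ≤ 12 * (Real.sqrt (O / n) + Real.sqrt (Real.log (1 / δ) / n)) := by
  have hn' : (0 : ℝ) < n := by exact_mod_cast hn0
  have hN' : (0 : ℝ) < N := by
    have : 0 < N := Nat.pos_of_ne_zero fun h => by simp [h] at hn; omega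
    exact_mod_cast this
  have hlog : 1 ≤ Real.log (1 / δ) := by
    rw [Real.le_log_iff_exp_le (by positivity)]
    have h1 : 9 ≤ 1 / δ := by
      rw [le_div_iff₀ hδ0]; linarith
    linarith [Real.exp_one_lt_d9]
  -- The 1 lost in the ceiling is absorbed by `log (1 / δ) ≥ 1`; then `129 ≤ 12 ^ 2` gives the
  -- factor 12.
  have hBle : (B : ℝ) ≤ 129 * Real.log (1 / δ) + 8 * O := by
    have h := Nat.ceil_lt_add_one (a := max (128 * Real.log (1 / δ)) (8 * O))
      (le_max_of_le_right (by positivity))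
    rw [← hB] at h
    have := max_le_add_of_nonneg (a := 128 * Real.log (1 / δ)) (b := 8 * O) (by positivity)
      (by positivity)
    linarith
  have h1 : Real.sqrt N / N = Real.sqrt (B / n) := by
    rw [Real.sqrt_div_self, ← hn]
    push_cast
    have hB0 : (B : ℝ) ≠ 0 := by
      rintro h
      have : B = 0 := by exact_mod_cast h
      simp [this] at hn
      omega
    rw [← div_div, div_self hB0, Real.sqrt_div zero_le_one, Real.sqrt_one, one_div]
  rw [h1, Real.sqrt_le_left (by positivity), mul_pow, add_sq, Real.sq_sqrt (by positivity),
    Real.sq_sqrt (by positivity)]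
  have h2 : (B : ℝ) / n ≤ 129 * (Real.log (1 / δ) / n) + 8 * (O / n) := by
    rw [← mul_div_assoc, ← mul_div_assoc, ← add_div]
    gcongr
  have h3 : 0 ≤ Real.sqrt (O / n) * Real.sqrt (Real.log (1 / δ) / n) := by positivity
  have h4 : 0 ≤ O / n := by positivity
  have h5 : 0 ≤ Real.log (1 / δ) / n := by positivity
  nlinarith

end Assembly

/-! ### The main theorem. -/

theorem theorem8 :
    -- the numerical constant hidden in `≲`
    ∃ C : ℝ, 0 < C ∧
    ∀ {Ω : Type*} [MeasurableSpace Ω] (P : Measure Ω) [IsProbabilityMeasure P]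
      (n d o B N : ℕ) (O δ L ρ σ r R : ℝ)
      (ν : Measure (EuclideanSpace ℝ (Fin d)))
      (x : Fin n → Ω → EuclideanSpace ℝ (Fin d)) (ξ θ y : Fin n → Ω → ℝ)
      (Out : Ω → Finset (Fin n))
      (βstar : EuclideanSpace ℝ (Fin d)) (μstar : ℝ)
      (βhat : Ω → EuclideanSpace ℝ (Fin d)) (μhat : Ω → ℝ),
      -- sizes
      0 < n → B * N = n → (o : ℝ) ≤ O → 0 < δ → δ ≤ 1 / 9 →
      0 < L → 0 < ρ → 0 ≤ σ → 0 ≤ r → 0 ≤ R →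
      -- i.i.d. covariates with an `L`-subGaussian law whose variances are at most `ρ²`
      iIndepFun x P → (∀ i, HasLaw (x i) ν P) → IsSubGaussianLaw L ν →
      (∀ j, covMat ν j j ≤ ρ ^ 2) →
      -- i.i.d. centred noise with finite variance `σ²`
      iIndepFun ξ P → (∀ i j, IdentDistrib (ξ i) (ξ j) P P) →
      (∀ i, MemLp (ξ i) 2 P) → (∀ i, ∫ ω, ξ i ω ∂P = 0) → (∀ i, ∫ ω, |ξ i ω| ^ 2 ∂P = σ ^ 2) →
      -- arbitrary outliers: positions and values may depend on everything
      (∀ ω, (Out ω).card = o) → (∀ ω, ∀ i ∉ Out ω, θ i ω = 0) →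
      (∀ i ω, y i ω = inner ℝ (x i ω) βstar + μstar + Real.sqrt n * θ i ω + ξ i ω) →
      -- number of blocks, and the condition on the radius
      B = ⌈max (128 * Real.log (1 / δ)) (8 * O)⌉₊ → ρ * R ≤ 1 →
      -- the given coefficient estimator, and the output of the algorithm
      (∀ᵐ ω ∂P, βhat ω - βstar ∈ Vmean n ν σ r R) →
      (∀ ω, IsInterceptEstimate B N (fun i => y i ω) (fun i => x i ω) (βhat ω) (μhat ω)) →
      -- with probability at least `1 - δ` (the event below need not be measurable itself, as no
      -- measurability of the outliers and of the coefficient estimator is assumed)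
      ∃ E : Set Ω, MeasurableSet E ∧ ENNReal.ofReal (1 - δ) ≤ P E ∧
        ∀ ω ∈ E, |μhat ω - μstar| ≤
          C * (σ * (1 + r) * (Real.sqrt (O / n) + Real.sqrt (Real.log (1 / δ) / n))
            + L * σ * r) := by

  refine ⟨12 * Real.exp 8 + 101, by positivity, ?_⟩
  intro Ω _ P _ n d o B N O δ L ρ σ r R ν x ξ θ y Out βstar μstar βhat μhat hn0 hn hoO hδ0 hδ hL hρ0
    hσ hr hR hx hlaw hν hρ hξ _ hξ2 hξ0 hξv hOut hθ hy hB hρR hβ hμ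
  have hB0 : 0 < B := Nat.pos_of_ne_zero fun h => by simp [h] at hn; omega
  have hN0 : 0 < N := Nat.pos_of_ne_zero fun h => by simp [h] at hn; omega
  have hO : 0 ≤ O := (Nat.cast_nonneg o).trans hoO
  have hBn : B ≤ n := hn ▸ Nat.le_mul_of_pos_right B hN0
  have hBceil : max (128 * Real.log (1 / δ)) (8 * O) ≤ B := hB ▸ Nat.le_ceil _
  set c := Real.exp 8 * σ * Real.sqrt N with hc
  set t := 101 * (L * (σ * r)) with ht
  set Aξ : Finset (Fin B) → Set Ω := fun K =>
    {ω | B ≤ 8 * K.card ∧ ∀ k ∈ K, c < |∑ i ∈ blockSet n N k, ξ i ω|} with hAξ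
  set Ax : Finset (Fin B) → Set Ω := fun K =>
    {ω | B ≤ 16 * K.card ∧ ∃ v ∈ Vmean n ν σ r R,
      (K.card * N : ℕ) * t < inner ℝ (∑ i ∈ K.biUnion fun k => blockSet n N k, x i ω) v} with hAx
  have hPξ : P (⋃ K, Aξ K) ≤ ENNReal.ofReal (Real.exp (-B)) := by
    refine measure_iUnion_finset_le fun K => ?_
    -- With at least `B / 8` independent blocks, `exp (-16)` per block yields `exp (-2 B)`, enough
    -- to beat the `2 ^ B` choices of `K`.
    by_cases hK : B ≤ 8 * K.card
    · have h := measure_forall_lt_abs_sum_le hξ (fun i => (hξ2 i).aemeasurable)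
        (b := fun k : Fin B => blockSet n N k)
        (fun k l hkl => pairwise_disjoint_blockSet n N (Fin.val_injective.ne hkl)) c
        (ENNReal.ofReal (Real.exp (-16)))
        (fun k => by
          have := measure_lt_abs_sum_le hξ hξ2 hξ0 hσ hξv (blockSet n N k)
          rwa [card_blockSet hn k.2] at this) K
      refine (measure_mono fun ω hω => hω.2).trans (h.trans ?_)
      rw [← ENNReal.ofReal_pow (Real.exp_pos _).le, ← Real.exp_nat_mul]
      apply ENNReal.ofReal_le_ofReal
      apply Real.exp_le_exp.2
      have : (B : ℝ) ≤ 8 * K.card := by exact_mod_cast hK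
      linarith
    · exact (measure_mono_null (t := ∅) (fun ω hω => hK hω.1) measure_empty).trans_le zero_le
  have hPx : P (⋃ K, Ax K) ≤ ENNReal.ofReal (Real.exp (-B)) := by
    refine measure_iUnion_finset_le fun K => ?_
    by_cases hK : B ≤ 16 * K.card
    · have hcard := card_biUnion_blockSet hn K
      have h := measure_exists_lt_inner_sum_le hn0 hL hρ0 hσ hr hR hρR hx hlaw hν hρ
        (K.biUnion fun k => blockSet n N k)
        (by rw [hcard, ← hn, ← mul_assoc]; exact Nat.mul_le_mul_right N hK)
      rw [hcard] at h
      refine (measure_mono fun ω hω => hω.2).trans (h.trans (ENNReal.ofReal_le_ofReal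
        (Real.exp_le_exp.2 ?_)))
      have : (B : ℝ) ≤ n := by exact_mod_cast hBn
      linarith
    · exact (measure_mono_null (t := ∅) (fun ω hω => hK hω.1) measure_empty).trans_le zero_le
  set bad : Set Ω := ((⋃ K, Aξ K) ∪ ⋃ K, Ax K) ∪ {ω | ¬ βhat ω - βstar ∈ Vmean n ν σ r R} with hbad
  have hPbad : P bad ≤ ENNReal.ofReal δ := by
    have hexp : Real.exp (-B) ≤ δ / 2 := by
      have hlog : Real.log (9 : ℝ) ≤ Real.log (1 / δ) := by
        apply Real.log_le_log (by norm_num)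
        rw [le_div_iff₀ hδ0]
        linarith
      have hlog2 : Real.log 2 ≤ Real.log (9 : ℝ) := Real.log_le_log (by norm_num) (by norm_num)
      have hlog0 : 0 ≤ Real.log 2 := Real.log_nonneg (by norm_num)
      have hB1 := (le_max_left _ _).trans hBceil
      rw [← Real.le_log_iff_exp_le (by positivity), Real.log_div hδ0.ne' (by norm_num)]
      rw [one_div, Real.log_inv] at hB1 hlog
      linarith
    calc P bad ≤ P ((⋃ K, Aξ K) ∪ ⋃ K, Ax K) + P {ω | ¬ βhat ω - βstar ∈ Vmean n ν σ r R} :=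
          measure_union_le _ _
      _ = P ((⋃ K, Aξ K) ∪ ⋃ K, Ax K) := by rw [ae_iff.1 hβ, add_zero]
      _ ≤ P (⋃ K, Aξ K) + P (⋃ K, Ax K) := measure_union_le _ _
      _ ≤ ENNReal.ofReal (δ / 2) + ENNReal.ofReal (δ / 2) :=
          add_le_add (hPξ.trans (ENNReal.ofReal_le_ofReal hexp))
            (hPx.trans (ENNReal.ofReal_le_ofReal hexp))
      _ = ENNReal.ofReal δ := by
          rw [← ENNReal.ofReal_add (by positivity) (by positivity), add_halves]
  -- `bad` need not be measurable, so its measurable hull, of the same measure, is removed.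
  refine ⟨(toMeasurable P bad)ᶜ, (measurableSet_toMeasurable P bad).compl, ?_, fun ω hω => ?_⟩
  · rw [prob_compl_eq_one_sub (measurableSet_toMeasurable P bad), measure_toMeasurable,
      ENNReal.ofReal_sub _ hδ0.le, ENNReal.ofReal_one]
    exact tsub_le_tsub_left hPbad 1
  have hωbad : ω ∉ bad := fun h => hω (subset_toMeasurable P bad h)
  have hv : βhat ω - βstar ∈ Vmean n ν σ r R := by
    by_contra h
    exact hωbad (Or.inr h)
  have hωξ : ∀ K, ω ∉ Aξ K := fun K h => hωbad (Or.inl (Or.inl (Set.mem_iUnion.2 ⟨K, h⟩)))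
  have hωx : ∀ v ∈ Vmean n ν σ r R, ∀ K : Finset (Fin B), B ≤ 16 * K.card →
      inner ℝ (∑ i ∈ K.biUnion fun k => blockSet n N k, x i ω) v ≤ (K.card * N : ℕ) * t :=
    fun v hv K hK => by
      by_contra! h
      exact hωbad (Or.inl (Or.inr (Set.mem_iUnion.2 ⟨K, hK, v, hv, h⟩)))
  have key := abs_sub_le_of_isInterceptEstimate (c := c) (t := t) hN0 hn
    (by
      have h1 := (le_max_right _ _).trans hBceil
      have h2 : (8 * o : ℝ) ≤ B := by linarith
      rw [hOut ω]
      exact_mod_cast h2)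
    (hθ ω) (fun i => hy i ω)
    (by
      by_contra! h
      exact hωξ _ ⟨h, fun k hk => (Finset.mem_filter.1 hk).2⟩)
    (card_filter_lt_of_forall_sum_le hB0 (hωx _ hv))
    (card_filter_lt_of_forall_sum_le hB0 (hωx _ (neg_mem_Vmean hv))) (hμ ω)
  have hrate := sqrt_div_le_of_eq_ceil hn0 hn hO hδ0 hδ hB
  set q := Real.sqrt (O / n) + Real.sqrt (Real.log (1 / δ) / n) with hq
  have hq0 : 0 ≤ q := by positivity
  have h1 : c / N ≤ 12 * Real.exp 8 * (σ * (1 + r) * q) := by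
    calc c / N = Real.exp 8 * σ * (Real.sqrt N / N) := by rw [hc]; ring
      _ ≤ Real.exp 8 * σ * (12 * q) := by gcongr
      _ = 12 * Real.exp 8 * (σ * 1 * q) := by ring
      _ ≤ 12 * Real.exp 8 * (σ * (1 + r) * q) := by
          gcongr
          linarith
  have h2 : 0 ≤ 101 * (σ * (1 + r) * q) := by positivity
  have h3 : 0 ≤ 12 * Real.exp 8 * (L * σ * r) := by positivity
  calc |μhat ω - μstar| ≤ c / N + t := key
    _ ≤ (12 * Real.exp 8 + 101) * (σ * (1 + r) * q + L * σ * r) := by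
        rw [ht]
        nlinarith
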